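/- **Proposition 4.1 (values of $\omega$ on $G$).** Let $q$ be a power of an odd prime $p$, $F=GF(q)$, $n\ge 0$, and let $\psi(\alpha)=e^{(2\pi i/p)\,\mathrm{tr}(\alpha)}$ be the canonical additive character of $F$ (with $\mathrm{tr}:F\to GF(p)$ the trace), $\chi$ the quadratic character of $F^{\times}$, $\delta=\chi(-1)$, and $\rho=\sum_{\alpha\in F}\psi(\alpha^2)$ the quadratic Gauss sum. Let $\mathrm{Sp}(2n,q)$ act on the right on the row vectors $(x,y)\in V=F^{n}\oplus F^{n}$, preserving $\varphi((x_1,y_1),(x_2,y_2))=x_1y_2^{T}-y_1x_2^{T}$. For $v=(x,y)\in V$ let $\pi(v)$ be the operator $(\pi(v)f)(t)=\psi(2xt^{T}-xy^{T})\,f(t-y)$ on the space of functions $f:F^{n}\to\mathbb{C}$, so that $\pi(u)\pi(v)=\psi(\varphi(u,v))\,\pi(u+v)$. The Weil representation is the representation $W$ of $\mathrm{Sp}(2n,q)$ on this space such that $W(g)^{-1}\pi(v)W(g)=\pi(vg)$ for all $g\in\mathrm{Sp}(2n,q)$ and $v\in V$; if $(n,q)=(1,3)$, where this property does not determine $W$,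 it is required in addition that there be a representation $W'$ of $\mathrm{Sp}(4,3)$ with the same property for $n=2$ such that $W'(g\oplus 1)=W(g)\otimes 1$ for all $g\in\mathrm{Sp}(2,3)$. Such a $W$ exists; let $\omega$ be its character. For a symmetric $n\times n$ matrix $Q$ over $F$ put $g_Q=\begin{bmatrix} I&0\\ Q&I\end{bmatrix}\in \mathrm{Sp}(2n,q)$, and let $\Delta(Q)=\chi(d)$, where $d$ is the product of the nonzero diagonal entries in a diagonalization $PQP^{T}$ of $Q$ ($P$ invertible), that is, the determinant of the nonsingular part of $Q$; $\Delta(0)=1$. Then for every symmetric $Q$ $$\omega(g_Q)=q^{n}\rho^{-\operatorname{rank}Q}\,\Delta(Q),\qquad \omega(-g_Q)=\delta^{n}.$$ -/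

import Mathlib

open Matrix

noncomputable section

namespace WeilSp

section Field

variable (p : ℕ) [Fact p.Prime] (F : Type*) [Field F] [Fintype F] [Algebra (ZMod p) F]

/-- The canonical additive character `ψ(α) = exp((2πi/p) tr α)` of a finite field `F` of
characteristic `p`, where `tr : F → 𝔽_p` is the trace. -/
def psi : AddChar F ℂ :=
  (ZMod.stdAddChar (N := p)).compAddMonoidHom (Algebra.trace (ZMod p) F).toAddMonoidHom

/-- The quadratic Gauss sum `ρ = ∑_α ψ(α²)`. -/
def rho : ℂ := ∑ a : F, psi p F (a ^ 2)

/-- The quadratic character `χ` of `F`, with complex values. -/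
def chi [DecidableEq F] (a : F) : ℂ := ((quadraticChar F a : ℤ) : ℂ)

/-- The sign `δ = χ(-1)`. -/
def delta [DecidableEq F] : ℂ := chi F (-1)

end Field

section QuadraticForm

variable {F : Type*} [Field F] [Fintype F] [DecidableEq F] {ι : Type*} [Fintype ι] [DecidableEq ι]

/-- The form with matrix `Q` has matrix `diag(d)` with respect to some basis (the rows of `P`). -/
def IsDiagonalization (Q : Matrix ι ι F) (d : ι → F) : Prop :=
  ∃ P : Matrix ι ι F, IsUnit P.det ∧ P * Q * Pᵀ = Matrix.diagonal d

open Classical in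
/-- `Δ(Q)`: diagonalize `Q` and apply `χ` to the product of the nonzero diagonal entries.
The empty product gives `Δ(0) = 1`. (The last branch is never reached by a symmetric `Q` in odd
characteristic.) -/
def Delta (Q : Matrix ι ι F) : ℂ :=
  if h : ∃ d, IsDiagonalization Q d then
    chi F (∏ i ∈ Finset.univ.filter (fun i => h.choose i ≠ 0), h.choose i)
  else 1

end QuadraticForm

section Group

variable {F : Type*} [Field F] {ι : Type*} [Fintype ι] [DecidableEq ι]

/-- The symplectic matrix `g_Q` with block rows `[I 0]` and `[Q I]`, for symmetric `Q`.
(Mathlib's `symplecticGroup ι F` consists of the `A` with `A * J * Aᵀ = J`,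
where `J` is minus the matrix of the form `φ` below.) -/
def gQ (Q : Matrix ι ι F) (hQ : Q.IsSymm) : symplecticGroup ι F :=
  ⟨fromBlocks 1 0 Q 1, by
    rw [SymplecticGroup.mem_iff, J, fromBlocks_transpose, fromBlocks_multiply,
      fromBlocks_multiply]
    simp [hQ.eq]⟩

/-- The element `-g` of the symplectic group. -/
def neg (g : symplecticGroup ι F) : symplecticGroup ι F :=
  ⟨-(g : Matrix (ι ⊕ ι) (ι ⊕ ι) F), SymplecticGroup.neg_mem g.2⟩

/-- The symplectic form `φ((x₁, y₁), (x₂, y₂)) = x₁ · y₂ - y₁ · x₂` on row vectors. -/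
def phi (u v : ι ⊕ ι → F) : F :=
  (fun i => u (Sum.inl i)) ⬝ᵥ (fun i => v (Sum.inr i)) -
    (fun i => u (Sum.inr i)) ⬝ᵥ (fun i => v (Sum.inl i))

/-- The embedding `g ↦ g ⊕ 1` of `Sp(2n)` in `Sp(2(n+1)) = Sp(V ⊥ H)`, `H` a hyperbolic plane. -/
def stab (g : symplecticGroup ι F) : symplecticGroup (ι ⊕ Unit) F :=
  ⟨fromBlocks
      (fromBlocks (g : Matrix (ι ⊕ ι) (ι ⊕ ι) F).toBlocks₁₁ 0 0 1)
      (fromBlocks (g : Matrix (ι ⊕ ι) (ι ⊕ ι) F).toBlocks₁₂ 0 0 0)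
      (fromBlocks (g : Matrix (ι ⊕ ι) (ι ⊕ ι) F).toBlocks₂₁ 0 0 0)
      (fromBlocks (g : Matrix (ι ⊕ ι) (ι ⊕ ι) F).toBlocks₂₂ 0 0 1), by
    obtain ⟨g, hg⟩ := g
    rw [SymplecticGroup.mem_iff] at hg ⊢
    rw [← fromBlocks_toBlocks g, J, fromBlocks_transpose, fromBlocks_multiply,
      fromBlocks_multiply, fromBlocks_inj] at hg
    obtain ⟨h1, h2, h3, h4⟩ := hg
    have h0 : (0 : Matrix (ι ⊕ Unit) (ι ⊕ Unit) F) = fromBlocks 0 0 0 0 := fromBlocks_zero.symm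
    have h1' : (1 : Matrix (ι ⊕ Unit) (ι ⊕ Unit) F) = fromBlocks 1 0 0 1 := fromBlocks_one.symm
    rw [J, fromBlocks_transpose, fromBlocks_multiply, fromBlocks_multiply, fromBlocks_inj]
    simp only [h0, h1', fromBlocks_transpose, fromBlocks_multiply, fromBlocks_neg,
      fromBlocks_add, fromBlocks_inj, transpose_zero, transpose_one, Matrix.mul_zero,
      Matrix.mul_neg, Matrix.mul_one, Matrix.zero_mul, add_zero, zero_add, neg_zero,
      Matrix.neg_mul] at h1 h2 h3 h4 ⊢
    simp [h1, h2, h3, h4]⟩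

end Group

section Weil

variable (p : ℕ) [Fact p.Prime] {F : Type*} [Field F] [Fintype F] [Algebra (ZMod p) F]
  {ι : Type*} [Fintype ι] [DecidableEq ι]

/-- The Schrödinger operators on functions `F^n → ℂ`: the vector `v = (x, y)` acts by
`(π(v) f)(t) = ψ(2 x·t - x·y) f(t - y)`. They satisfy `π(u) π(v) = ψ(φ(u, v)) π(u + v)`, so they
give the action on the `q^n`-dimensional irreducible module of the twisted group algebra of `V = F^{2n}` with
multiplication `(u)(v) = ψ(φ(u, v)) (u + v)`. -/
def schrodinger (v : ι ⊕ ι → F) : ((ι → F) → ℂ) →ₗ[ℂ] ((ι → F) → ℂ) where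
  toFun f t :=
    psi p F (2 * ((fun i => v (Sum.inl i)) ⬝ᵥ t)
        - (fun i => v (Sum.inl i)) ⬝ᵥ (fun i => v (Sum.inr i)))
      * f (fun i => t i - v (Sum.inr i))
  map_add' f g := by ext t; simp [mul_add]
  map_smul' c f := by ext t; simp [mul_left_comm]

theorem schrodinger_comp (u v : ι ⊕ ι → F) :
    schrodinger p u ∘ₗ schrodinger p v = psi p F (phi u v) • schrodinger p (u + v) := by
  ext1 f
  funext t
  simp only [schrodinger, phi, LinearMap.comp_apply, LinearMap.coe_mk, AddHom.coe_mk,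
    LinearMap.smul_apply, Pi.smul_apply, smul_eq_mul, ← mul_assoc, ← AddChar.map_add_eq_mul,
    Pi.add_apply, sub_sub]
  congr 2
  · simp only [dotProduct, Finset.mul_sum, ← Finset.sum_sub_distrib, ← Finset.sum_add_distrib]
    exact Finset.sum_congr rfl fun i _ => by ring

/-- `W` lifts the action of `Sp(2n, q)` on the Schrödinger operators by automorphisms:
`W(g)⁻¹ π(v) W(g) = π(v g)`, with `g` acting on row vectors from the right. -/
def Implements (W : Representation ℂ (symplecticGroup ι F) ((ι → F) → ℂ)) : Prop :=
  ∀ (g : symplecticGroup ι F) (v : ι ⊕ ι → F),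
    schrodinger p v ∘ₗ W g = W g ∘ₗ schrodinger p (v ᵥ* (g : Matrix (ι ⊕ ι) (ι ⊕ ι) F))

/-- `W` is the Weil representation of `Sp(2n, q)` (with respect to `ψ`): a representation that
lifts the action of the group on the Schrödinger operators. Such a lift is unique unless
`(n, q) = (1, 3)`, because in all other cases `Sp(2n, q)` is perfect and so has no nontrivial linear
character. `Sp(2, 3)` has three linear characters, so there the lift has to be normalized: the Weil
representation of `Sp(2, 3)` is the one obtained from the (unique) Weil representation `W'` of
`Sp(4, 3)`, as the factor in `W'(g ⊕ 1) = W(g) ⊗ 1`. -/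
def IsWeilRepresentation (W : Representation ℂ (symplecticGroup ι F) ((ι → F) → ℂ)) : Prop :=
  Implements p W ∧
    (Fintype.card ι = 1 → Fintype.card F = 3 →
      ∃ W' : Representation ℂ (symplecticGroup (ι ⊕ Unit) F) ((ι ⊕ Unit → F) → ℂ),
        Implements p W' ∧
        ∀ (g : symplecticGroup ι F) (f : (ι → F) → ℂ) (h : F → ℂ),
          W' (stab g) (fun t => f (fun i => t (Sum.inl i)) * h (t (Sum.inr ())))
            = fun t => W g f (fun i => t (Sum.inl i)) * h (t (Sum.inr ())))

end Weil

end WeilSp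

end

set_option linter.unusedSectionVars false

noncomputable section

/-! The Schrödinger operators act irreducibly, so by Schur's lemma an operator that implements a
given `g` is unique up to a scalar. Multiplication by `ψ(-tQtᵀ)` implements `g_Q`, and the parity
`f(t) ↦ f(-t)` implements `-1`. Hence `W(g_Q)` and `W(-1)` are scalar multiples of these. The trace
of the multiplication operator is a product of Gauss sums once `Q` is diagonalized, and parity times
multiplication has trace 1, because only `t = 0` contributes. What remains is to find the two
scalars.

Scalar of `g_Q` (`unipotentScalar`): it is a character of the additive group of symmetric matrices,
invariant under congruence and of odd order. This forces it to be 1 when `q > 3` (scaling by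
squares) or `n ≥ 2` (transvections). For `(n, q) = (1, 3)` the normalization through `Sp(4, 3)`
reduces to `n = 2`.

Scalar of `-1`: by a matrix identity `det W(-1)` is a power of `det W(g_I)`, so it is both a `p`-th
root of unity and a sign, hence 1. The determinant of parity is `δ^n` and `q^n` is odd, so the
scalar is `δ^n`.

Existence: every implementer commutes with parity. The even functions exceed the odd ones by one
dimension, so the quotient of the determinants on the two parts (`detRatio`) scales linearly.
Normalizing it to 1 picks out one implementer for each `g`, compatibly with products
(`exists_implements`). -/

namespace WeilSp

/-! ### Quadratic Gauss sums. -/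

section Characters

variable (p : ℕ) [Fact p.Prime] (F : Type*) [Field F] [Fintype F] [Algebra (ZMod p) F]

theorem charP_of_algebra : CharP F p :=
  charP_of_injective_algebraMap (algebraMap (ZMod p) F).injective p

variable {p} in
theorem ringChar_ne_two (hp : p ≠ 2) : ringChar F ≠ 2 := by
  have := charP_of_algebra p F
  rwa [ringChar.eq F p]

variable {p} in
theorem two_ne_zero_of_odd (hp : p ≠ 2) : (2 : F) ≠ 0 :=
  Ring.two_ne_zero (ringChar_ne_two F hp)

theorem psi_isPrimitive : (psi p F).IsPrimitive := by
  apply AddChar.IsPrimitive.of_ne_one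
  intro h
  obtain ⟨a, ha⟩ := Algebra.trace_surjective (ZMod p) F 1
  have h1 : psi p F a = 1 := by rw [h]; rfl
  have h2 : ZMod.stdAddChar (N := p) 1 = 1 := by
    rw [← ha]; exact h1
  have h3 := ((ZMod.isPrimitive_stdAddChar p).zmod_char_eq_one_iff p 1).1 h2
  exact one_ne_zero h3

variable [DecidableEq F]

/-- The quadratic character with complex values. -/
def quadChar : MulChar F ℂ := (quadraticChar F).ringHomComp (Int.castRingHom ℂ)

theorem quadChar_apply (a : F) : quadChar F a = chi F a := rfl

theorem chi_mul (a b : F) : chi F (a * b) = chi F a * chi F b :=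
  map_mul (quadChar F) a b

theorem chi_prod {κ : Type*} (s : Finset κ) (f : κ → F) :
    chi F (∏ i ∈ s, f i) = ∏ i ∈ s, chi F (f i) :=
  map_prod (quadChar F) f s

theorem chi_sq {a : F} (ha : a ≠ 0) : chi F a ^ 2 = 1 := by
  unfold chi
  exact_mod_cast congrArg (Int.cast : ℤ → ℂ) (quadraticChar_sq_one ha)

theorem quadChar_isQuadratic : (quadChar F).IsQuadratic :=
  (quadraticChar_isQuadratic F).comp _

variable {p} (hp : p ≠ 2)
include hp

theorem quadChar_ne_one : quadChar F ≠ 1 := by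
  obtain ⟨a, ha⟩ := quadraticChar_exists_neg_one (ringChar_ne_two F hp)
  intro h
  have h1 : quadChar F a = -1 := by rw [quadChar_apply, chi, ha]; norm_num
  have ha0 : a ≠ 0 := by rintro rfl; simp at ha
  rw [h, MulChar.one_apply (isUnit_iff_ne_zero.2 ha0)] at h1
  norm_num at h1

/-- An element `b` has `1 + χ(b)` square roots, and the contribution of the 1 vanishes because `ψ`
is nontrivial. -/
theorem sum_psi_mul_sq_eq_gaussSum {a : F} (ha : a ≠ 0) :
    ∑ t : F, psi p F (a * t ^ 2) = gaussSum (quadChar F) ((psi p F).mulShift a) := by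
  have h1 : ∀ b : F, ((Finset.univ.filter fun x : F => x ^ 2 = b).card : ℂ) = chi F b + 1 := by
    intro b
    have := quadraticChar_card_sqrts (ringChar_ne_two F hp) b
    have h2 : ({x : F | x ^ 2 = b}.toFinset) = Finset.univ.filter fun x : F => x ^ 2 = b := by
      ext; simp
    rw [h2] at this
    have := congrArg (Int.cast : ℤ → ℂ) this
    push_cast at this
    exact this
  have h0 : ∑ b : F, psi p F (a * b) = 0 := by
    have := AddChar.sum_mulShift a (psi_isPrimitive p F)
    simp_rw [mul_comm a]
    rw [this, if_neg ha]; simp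
  rw [← Finset.sum_fiberwise Finset.univ (fun t : F => t ^ 2)]
  have h2 : ∀ b : F, ∑ t with t ^ 2 = b, psi p F (a * t ^ 2) = (chi F b + 1) * psi p F (a * b) := by
    intro b
    rw [← h1, Finset.sum_congr rfl (g := fun _ => psi p F (a * b)), Finset.sum_const, nsmul_eq_mul]
    intro t ht
    rw [(Finset.mem_filter.1 ht).2]
  simp only [h2, add_mul, one_mul, Finset.sum_add_distrib, h0, add_zero, gaussSum,
    AddChar.mulShift_apply, quadChar_apply]

theorem rho_eq_gaussSum : rho p F = gaussSum (quadChar F) (psi p F) := by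
  have := sum_psi_mul_sq_eq_gaussSum F hp one_ne_zero
  simpa [rho, AddChar.mulShift_one] using this

theorem sum_psi_mul_sq {a : F} (ha : a ≠ 0) :
    ∑ t : F, psi p F (a * t ^ 2) = chi F a * rho p F := by
  rw [sum_psi_mul_sq_eq_gaussSum F hp ha, rho_eq_gaussSum F hp,
    ← gaussSum_mulShift (quadChar F) (psi p F) (Units.mk0 a ha), Units.val_mk0, quadChar_apply,
    ← mul_assoc, ← sq, chi_sq F ha, one_mul]

theorem rho_sq : rho p F ^ 2 = delta F * Fintype.card F := by
  rw [rho_eq_gaussSum F hp,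
    gaussSum_sq (quadChar_ne_one F hp) (quadChar_isQuadratic F) (psi_isPrimitive p F)]
  rfl

theorem rho_ne_zero : rho p F ≠ 0 := by
  intro h
  have h1 := rho_sq F hp
  have h2 : delta F ^ 2 = 1 := chi_sq F (neg_ne_zero.2 one_ne_zero)
  rw [h] at h1
  have : delta F ≠ 0 := by rintro h; simp [h] at h2
  simp [this] at h1

/-- Since `ρ² = δq`, the value `δχ(a)ρ` equals `qρ⁻¹χ(a)`; this is the source of the negative
exponent of `ρ`. -/
theorem sum_psi_neg_mul_sq {a : F} (ha : a ≠ 0) :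
    ∑ t : F, psi p F (-(a * t ^ 2)) = Fintype.card F * (rho p F)⁻¹ * chi F a := by
  have h := sum_psi_mul_sq F hp (neg_ne_zero.2 ha)
  have h2 : delta F ^ 2 = 1 := chi_sq F (neg_ne_zero.2 one_ne_zero)
  simp only [neg_mul] at h
  have h3 : chi F (-a) = delta F * chi F a := by rw [delta, ← chi_mul]; simp
  have h0 := rho_ne_zero F hp
  rw [h, h3]
  field_simp
  rw [rho_sq F hp]
  linear_combination chi F a * (Fintype.card F : ℂ) * h2

end Characters

/-! ### Diagonalization and Gauss sums of quadratic forms. -/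

section Diagonalization

variable {p : ℕ} [Fact p.Prime] {F : Type*} [Field F] [Fintype F] [Algebra (ZMod p) F]
  {ι : Type*} [Fintype ι] [DecidableEq ι]

theorem exists_isDiagonalization (h2 : (2 : F) ≠ 0) {Q : Matrix ι ι F} (hQ : Q.IsSymm) :
    ∃ d, IsDiagonalization Q d := by
  have := invertibleOfNonzero h2
  obtain ⟨v, hv⟩ := LinearMap.BilinForm.exists_orthogonal_basis
    (B := Q.toBilin') (LinearMap.BilinForm.isSymm_iff.1 (Matrix.isSymm_toBilin'_iff_isSymm.2 hQ))
  have e : Fin (Module.finrank F (ι → F)) ≃ ι :=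
    Fintype.equivOfCardEq (by simp)
  let b := Pi.basisFun F ι
  let c := v.reindex e
  have h := LinearMap.BilinForm.toMatrix_mul_basis_toMatrix b c Q.toBilin'
  rw [LinearMap.BilinForm.toMatrix_basisFun, LinearMap.BilinForm.toMatrix'_toBilin'] at h
  refine ⟨fun i => Q.toBilin' (c i) (c i), (b.toMatrix c)ᵀ, ?_, ?_⟩
  · rw [det_transpose]
    have : b.toMatrix c * c.toMatrix b = 1 := b.toMatrix_mul_toMatrix_flip c
    exact Matrix.isUnit_det_of_right_inverse this
  · rw [transpose_transpose, h]
    ext i j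
    rw [LinearMap.BilinForm.toMatrix_apply]
    by_cases hij : i = j
    · subst hij; simp
    · rw [diagonal_apply_ne _ hij]
      have : e.symm i ≠ e.symm j := fun h => hij (e.symm.injective h)
      have := hv this
      simpa [c] using this

theorem IsDiagonalization.rank_eq {Q : Matrix ι ι F} {d : ι → F} [DecidableEq F]
    (h : IsDiagonalization Q d) :
    Q.rank = (Finset.univ.filter fun i => d i ≠ 0).card := by
  obtain ⟨P, hP, h⟩ := h
  have h1 : (P * Q * Pᵀ).rank = Q.rank := by
    rw [Matrix.rank_mul_eq_left_of_isUnit_det _ _ (by rwa [det_transpose]),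
      Matrix.rank_mul_eq_right_of_isUnit_det _ _ hP]
  rw [← h1, h, Matrix.rank_diagonal, Fintype.card_subtype]

/-- The quadratic form `t ↦ t Q tᵀ`. -/
def quadForm (Q : Matrix ι ι F) (t : ι → F) : F := t ⬝ᵥ (Q *ᵥ t)

omit [Fintype F] [DecidableEq ι] in
theorem quadForm_conj (Q P : Matrix ι ι F) (t : ι → F) :
    quadForm (P * Q * Pᵀ) t = quadForm Q (t ᵥ* P) := by
  rw [quadForm, quadForm, ← Matrix.mulVec_mulVec, ← Matrix.mulVec_mulVec, Matrix.mulVec_transpose,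
    Matrix.dotProduct_mulVec]

theorem sum_quadForm_conj {M : Type*} [AddCommMonoid M] (f : F → M) (Q P : Matrix ι ι F)
    (hP : IsUnit P.det) :
    ∑ t, f (quadForm (P * Q * Pᵀ) t) = ∑ t, f (quadForm Q t) := by
  simp only [quadForm_conj]
  have hP' : IsUnit P := (Matrix.isUnit_iff_isUnit_det P).2 hP
  exact Fintype.sum_bijective (fun t => t ᵥ* P)
    ((Fintype.bijective_iff_injective_and_card _).2 ⟨Matrix.vecMul_injective_of_isUnit hP', rfl⟩)
    _ _ fun _ => rfl

/-- The sum is invariant under congruence and factors over a diagonal form. The diagonalization used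
is the very one chosen in `Delta`, so independence of that choice is not needed. -/
theorem sum_psi_quadForm [DecidableEq F] (hp : p ≠ 2) {Q : Matrix ι ι F} (hQ : Q.IsSymm) :
    ∑ t, psi p F (-quadForm Q t) =
      (Fintype.card F : ℂ) ^ Fintype.card ι * rho p F ^ (-(Q.rank : ℤ)) * Delta Q := by
  have hex := exists_isDiagonalization (two_ne_zero_of_odd F hp) hQ
  obtain ⟨P, hP, h⟩ := hex.choose_spec
  have hr := hex.choose_spec.rank_eq
  rw [Delta, dif_pos hex, hr, ← sum_quadForm_conj (fun a => psi p F (-a)) Q P hP, h]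
  generalize hex.choose = d
  have h1 : ∀ t : ι → F, psi p F (-quadForm (diagonal d) t) =
      ∏ i, psi p F (-(d i * t i ^ 2)) := by
    intro t
    have : -quadForm (diagonal d) t = ∑ i, (-(d i * t i ^ 2)) := by
      simp only [quadForm, dotProduct, mulVec_diagonal, Finset.sum_neg_distrib]
      congr 1
      exact Finset.sum_congr rfl fun i _ => by ring
    rw [this]
    exact map_prod (psi p F).toMonoidHom
      (fun i => Multiplicative.ofAdd (-(d i * t i ^ 2))) Finset.univ
  have h2 : ∀ i, ∑ a, psi p F (-(d i * a ^ 2)) =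
      Fintype.card F * if d i ≠ 0 then (rho p F)⁻¹ * chi F (d i) else 1 := by
    intro i
    by_cases hi : d i = 0
    · simp [hi]
    · rw [sum_psi_neg_mul_sq F hp hi, if_pos hi, mul_assoc]
  simp only [h1]
  rw [← Fintype.piFinset_univ,
    ← Finset.prod_univ_sum (fun _ => Finset.univ) (fun i a => psi p F (-(d i * a ^ 2)))]
  simp only [h2]
  rw [Finset.prod_mul_distrib, ← Finset.prod_filter, Finset.prod_mul_distrib, ← chi_prod]
  simp only [Finset.prod_const, Finset.card_univ, mul_assoc, _root_.zpow_neg, zpow_natCast, inv_pow]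

end Diagonalization

/-! ### Irreducibility and traces of the Schrödinger operators. -/

section Schrodinger

variable (p : ℕ) [Fact p.Prime] {F : Type*} [Field F] [Fintype F] [Algebra (ZMod p) F]
  {ι : Type*} [Fintype ι] [DecidableEq ι]

theorem psi_sum {κ : Type*} (s : Finset κ) (f : κ → F) :
    psi p F (∑ i ∈ s, f i) = ∏ i ∈ s, psi p F (f i) :=
  map_prod (psi p F).toMonoidHom (fun i => Multiplicative.ofAdd (f i)) s

theorem sum_psi_dotProduct [DecidableEq F] (u : ι → F) :
    ∑ x : ι → F, psi p F (x ⬝ᵥ u) =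
      if u = 0 then (Fintype.card F : ℂ) ^ Fintype.card ι else 0 := by
  simp only [dotProduct, psi_sum]
  rw [← Fintype.piFinset_univ,
    ← Finset.prod_univ_sum (fun _ => Finset.univ) (fun i a => psi p F (a * u i))]
  simp only [AddChar.sum_mulShift _ (psi_isPrimitive p F)]
  split_ifs with h
  · simp [h]
  · obtain ⟨i, hi⟩ := Function.ne_iff.1 h
    exact Finset.prod_eq_zero (Finset.mem_univ i) (by simpa using hi)

theorem schrodinger_apply (v : ι ⊕ ι → F) (f : (ι → F) → ℂ) (t : ι → F) :
    schrodinger p v f t = psi p F (2 * ((v ∘ Sum.inl) ⬝ᵥ t) - (v ∘ Sum.inl) ⬝ᵥ (v ∘ Sum.inr)) *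
      f (t - v ∘ Sum.inr) := rfl

theorem schrodinger_zero : schrodinger p (0 : ι ⊕ ι → F) = LinearMap.id := by
  ext1 f
  funext t
  have h (a : ι → ι ⊕ ι) : (0 : ι ⊕ ι → F) ∘ a = 0 := rfl
  simp [schrodinger_apply, h]

theorem schrodinger_mul (u v : ι ⊕ ι → F) :
    schrodinger p u * schrodinger p v = psi p F (phi u v) • schrodinger p (u + v) :=
  schrodinger_comp p u v

theorem schrodinger_single (y : ι → F) [DecidableEq (ι → F)] (a : ι → F) (c : ℂ) :
    schrodinger p (Sum.elim 0 y) (Pi.single a c) = Pi.single (a + y) c := by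
  funext t
  simp only [schrodinger_apply, Sum.elim_comp_inl, Sum.elim_comp_inr, zero_dotProduct, mul_zero,
    sub_zero, AddChar.map_zero_eq_one, one_mul, Pi.single_apply, sub_eq_iff_eq_add]

variable {p} (hp : p ≠ 2)
include hp

/-- Fourier inversion: an invariant subspace containing `f` also contains the point mass `f(s)` at
`s`. Translations then yield all point masses. -/
theorem single_eq_sum_schrodinger [DecidableEq F] (f : (ι → F) → ℂ) (s : ι → F) :
    ((Fintype.card F : ℂ) ^ Fintype.card ι) • Pi.single s (f s) =
      ∑ x : ι → F, psi p F (-(2 * (x ⬝ᵥ s))) • schrodinger p (Sum.elim x 0) f := by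
  funext t
  simp only [Finset.sum_apply, Pi.smul_apply, schrodinger_apply, Sum.elim_comp_inl,
    Sum.elim_comp_inr, dotProduct_zero, sub_zero, smul_eq_mul, ← mul_assoc,
    ← AddChar.map_add_eq_mul]
  rw [← Finset.sum_mul]
  have h : ∀ x : ι → F, -(2 * (x ⬝ᵥ s)) + 2 * (x ⬝ᵥ t) = x ⬝ᵥ ((2 : F) • (t - s)) := by
    intro x
    rw [dotProduct_smul, dotProduct_sub, smul_eq_mul]; ring
  simp only [h, sum_psi_dotProduct, smul_eq_zero, two_ne_zero_of_odd F hp, sub_eq_zero, false_or,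
    Pi.single_apply]
  split_ifs with h1
  · rw [h1]
  · simp

/-- The Schrödinger operators act irreducibly. -/
theorem eq_top_of_schrodinger_invariant (S : Submodule ℂ ((ι → F) → ℂ))
    (hS : ∀ v, ∀ f ∈ S, schrodinger p v f ∈ S) (h0 : S ≠ ⊥) : S = ⊤ := by
  classical
  obtain ⟨f, hf, hf0⟩ := S.exists_mem_ne_zero_of_ne_bot h0
  obtain ⟨s, hs⟩ := Function.ne_iff.1 hf0
  have hq : ((Fintype.card F : ℂ) ^ Fintype.card ι) ≠ 0 :=
    pow_ne_zero _ (Nat.cast_ne_zero.2 Fintype.card_ne_zero)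
  have h1 : (Pi.single s (f s) : (ι → F) → ℂ) ∈ S := by
    rw [← S.smul_mem_iff hq, single_eq_sum_schrodinger hp]
    exact S.sum_mem fun x _ => S.smul_mem _ (hS _ _ hf)
  have h2 : ∀ a c, (Pi.single a c : (ι → F) → ℂ) ∈ S := by
    intro a c
    have := S.smul_mem (c / f s) (hS (Sum.elim 0 (a - s)) _ h1)
    rw [schrodinger_single p] at this
    rwa [add_sub_cancel, ← Pi.single_smul, smul_eq_mul, div_mul_cancel₀ _ hs] at this
  rw [eq_top_iff]
  intro g _
  rw [← Finset.univ_sum_single g]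
  exact S.sum_mem fun a _ => h2 _ _

theorem exists_eq_smul_one_of_commute {A : Module.End ℂ ((ι → F) → ℂ)}
    (hA : ∀ v, schrodinger p v * A = A * schrodinger p v) : ∃ c : ℂ, A = c • 1 := by
  obtain ⟨c, hc⟩ := Module.End.exists_eigenvalue A
  refine ⟨c, ?_⟩
  have := eq_top_of_schrodinger_invariant hp (A.eigenspace c) (fun v f hf => ?_) hc
  · ext1 f
    have hf : f ∈ A.eigenspace c := this ▸ Submodule.mem_top
    simpa using Module.End.mem_eigenspace_iff.1 hf
  · rw [Module.End.mem_eigenspace_iff] at hf ⊢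
    have := LinearMap.congr_fun (hA v) f
    simp only [Module.End.mul_apply] at this
    rw [← this, hf, map_smul]

/-- The left side is the trace of `π(v)`: a translation by `y ≠ 0` has no diagonal entries, and for
`y = 0` a nontrivial character is summed unless `x = 0`. -/
theorem sum_schrodinger_single [DecidableEq F] (v : ι ⊕ ι → F) :
    ∑ a : ι → F, schrodinger p v (Pi.single a 1) a =
      if v = 0 then (Fintype.card F : ℂ) ^ Fintype.card ι else 0 := by
  have h : v = 0 ↔ v ∘ Sum.inr = 0 ∧ v ∘ Sum.inl = 0 := by
    constructor
    · rintro rfl; exact ⟨rfl, rfl⟩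
    · rintro ⟨h1, h2⟩
      funext i
      cases i with
      | inl i => exact congrFun h2 i
      | inr i => exact congrFun h1 i
  simp only [schrodinger_apply, Pi.single_apply, sub_eq_self, mul_ite, mul_one, mul_zero]
  by_cases h1 : v ∘ Sum.inr = 0
  · simp only [h1, if_true, dotProduct_zero, sub_zero, h, true_and]
    have h2 : ∀ a, 2 * (v ∘ Sum.inl ⬝ᵥ a) = a ⬝ᵥ ((2 : F) • (v ∘ Sum.inl)) := by
      intro a; rw [dotProduct_smul, dotProduct_comm, smul_eq_mul]
    simp only [h2, sum_psi_dotProduct, smul_eq_zero, two_ne_zero_of_odd F hp, false_or]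
  · simp [h1, h]

end Schrodinger

/-! ### Operators implementing a symplectic matrix: uniqueness up to scalars, existence. -/

section Implementers

variable (p : ℕ) [Fact p.Prime] {F : Type*} [Field F] [Fintype F] [Algebra (ZMod p) F]
  {ι : Type*} [Fintype ι] [DecidableEq ι]

theorem phi_eq (u v : ι ⊕ ι → F) : phi u v = -(u ⬝ᵥ (J ι F *ᵥ v)) := by
  conv_rhs => rw [← Sum.elim_comp_inl_inr u, ← Sum.elim_comp_inl_inr v, J, fromBlocks_mulVec,
    sumElim_dotProduct_sumElim]
  simp [phi, neg_mulVec, Function.comp_def, sub_eq_add_neg, add_comm]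

theorem phi_neg_add_self (u v : ι ⊕ ι → F) : phi (-(u + v)) u = phi u v := by
  simp only [phi, dotProduct, ← Finset.sum_sub_distrib]
  refine Finset.sum_congr rfl fun i _ => ?_
  simp only [Pi.neg_apply, Pi.add_apply]
  ring

theorem phi_vecMul (g : symplecticGroup ι F) (u v : ι ⊕ ι → F) :
    phi (u ᵥ* (g : Matrix (ι ⊕ ι) (ι ⊕ ι) F)) (v ᵥ* (g : Matrix (ι ⊕ ι) (ι ⊕ ι) F)) = phi u v := by
  rw [phi_eq, phi_eq, ← dotProduct_mulVec, ← mulVec_transpose (g : Matrix (ι ⊕ ι) (ι ⊕ ι) F) v,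
    mulVec_mulVec, mulVec_mulVec, SymplecticGroup.mem_iff.1 g.2]

/-- `A` intertwines the Schrödinger operators with their twists by `g`. -/
def Intertwines (g : symplecticGroup ι F) (A : Module.End ℂ ((ι → F) → ℂ)) : Prop :=
  ∀ v, schrodinger p v * A = A * schrodinger p (v ᵥ* (g : Matrix (ι ⊕ ι) (ι ⊕ ι) F))

variable {p}

theorem Intertwines.mul {g h : symplecticGroup ι F} {A B : Module.End ℂ ((ι → F) → ℂ)}
    (hA : Intertwines p g A) (hB : Intertwines p h B) : Intertwines p (g * h) (A * B) := by
  intro v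
  rw [← mul_assoc, hA v, mul_assoc, hB, mul_assoc, vecMul_vecMul]
  rfl

theorem Intertwines.smul {g : symplecticGroup ι F} {A : Module.End ℂ ((ι → F) → ℂ)}
    (hA : Intertwines p g A) (c : ℂ) : Intertwines p g (c • A) := by
  intro v
  rw [mul_smul_comm, hA v, smul_mul_assoc]

theorem intertwines_one : Intertwines p (1 : symplecticGroup ι F) 1 := by
  intro v
  simp

/-- Averaging an operator over the Schrödinger operators yields an intertwiner. -/
theorem intertwines_average (g : symplecticGroup ι F) (X : Module.End ℂ ((ι → F) → ℂ)) :
    Intertwines p g (∑ v : ι ⊕ ι → F, schrodinger p v * X *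
      schrodinger p (-(v ᵥ* (g : Matrix (ι ⊕ ι) (ι ⊕ ι) F)))) := by
  intro u
  rw [Finset.mul_sum, Finset.sum_mul]
  -- After the substitution `v ↦ u + v` both sides carry the phase `ψ(φ(u, v))`, because `φ` is
  -- invariant under `g`.
  refine Fintype.sum_equiv (Equiv.addLeft u) _ _ fun v => ?_
  rw [Equiv.coe_addLeft, ← mul_assoc, ← mul_assoc, schrodinger_mul, mul_assoc _ (schrodinger p _),
    schrodinger_mul, add_vecMul, phi_neg_add_self, phi_vecMul, smul_mul_assoc, smul_mul_assoc,
    mul_smul_comm, neg_add_rev, neg_add_cancel_right]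

/-- The kernel is invariant under all Schrödinger operators, so irreducibility makes it zero. -/
theorem Intertwines.isUnit (hp : p ≠ 2) {g : symplecticGroup ι F}
    {A : Module.End ℂ ((ι → F) → ℂ)} (hA : Intertwines p g A) (h0 : A ≠ 0) : IsUnit A := by
  rw [LinearMap.isUnit_iff_ker_eq_bot]
  by_contra h
  apply h0
  rw [← LinearMap.ker_eq_top]
  refine eq_top_of_schrodinger_invariant hp _ (fun v f hf => ?_) h
  have h1 := LinearMap.congr_fun (hA (v ᵥ* ((g⁻¹ : symplecticGroup ι F) :
    Matrix (ι ⊕ ι) (ι ⊕ ι) F))) f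
  rw [vecMul_vecMul, ← Submonoid.coe_mul, inv_mul_cancel] at h1
  simp only [Module.End.mul_apply, LinearMap.mem_ker.1 hf, map_zero, OneMemClass.coe_one,
    vecMul_one] at h1
  exact h1.symm

theorem Intertwines.inv {g : symplecticGroup ι F} {A B : Module.End ℂ ((ι → F) → ℂ)}
    (hA : Intertwines p g A) (hAB : A * B = 1) (hBA : B * A = 1) : Intertwines p g⁻¹ B := by
  intro v
  have h1 := hA (v ᵥ* ((g⁻¹ : symplecticGroup ι F) : Matrix (ι ⊕ ι) (ι ⊕ ι) F))
  rw [vecMul_vecMul, ← Submonoid.coe_mul, inv_mul_cancel, OneMemClass.coe_one, vecMul_one] at h1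
  calc _ = B * (A * schrodinger p v) * B := by rw [← mul_assoc B, hBA, one_mul]
    _ = _ := by rw [← h1, mul_assoc, mul_assoc, hAB, mul_one]

theorem Intertwines.exists_eq_smul (hp : p ≠ 2) {g : symplecticGroup ι F}
    {A B : Module.End ℂ ((ι → F) → ℂ)} (hA : Intertwines p g A) (hB : Intertwines p g B)
    (hB0 : B ≠ 0) : ∃ c : ℂ, A = c • B := by
  obtain ⟨u, rfl⟩ := hB.isUnit hp hB0
  have h := hA.mul (hB.inv u.mul_inv u.inv_mul)
  rw [mul_inv_cancel] at h
  obtain ⟨c, hc⟩ := exists_eq_smul_one_of_commute hp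
    (A := A * (↑u⁻¹ : Module.End ℂ ((ι → F) → ℂ))) (fun v => by simpa using h v)
  exact ⟨c, by rw [← mul_one A, ← u.inv_mul, ← mul_assoc, hc, smul_mul_assoc, one_mul]⟩

/-- Some average of a rank-one operator is nonzero. Otherwise the diagonal sum `h2` over the
operators `X a` would vanish; but it brings in the trace of `π(v)`, so only `v = 0` survives and the
sum is `q^n`. -/
theorem exists_intertwines (hp : p ≠ 2) (g : symplecticGroup ι F) :
    ∃ A, Intertwines p g A ∧ A ≠ 0 := by
  classical
  by_contra! h
  let X : (ι → F) → Module.End ℂ ((ι → F) → ℂ) := fun a =>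
    (LinearMap.single ℂ (fun _ : ι → F => ℂ) a) ∘ₗ LinearMap.proj 0
  have hX : ∀ a f, X a f = f 0 • Pi.single a 1 := by
    intro a f
    simp [X, ← Pi.single_smul]
  have h1 := fun a => h _ (intertwines_average (p := p) g (X a))
  have h2 : ∑ a : ι → F, (∑ v : ι ⊕ ι → F, schrodinger p v * X a *
      schrodinger p (-(v ᵥ* (g : Matrix (ι ⊕ ι) (ι ⊕ ι) F)))) (Pi.single 0 1) a = 0 :=
    Finset.sum_eq_zero fun a _ => by rw [h1]; rfl
  simp only [LinearMap.sum_apply, Module.End.mul_apply, hX, map_smul, Finset.sum_apply,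
    Pi.smul_apply] at h2
  rw [Finset.sum_comm] at h2
  simp only [← Finset.smul_sum, sum_schrodinger_single hp] at h2
  simp [schrodinger_zero, Fintype.card_ne_zero] at h2

end Implementers

/-! ### Determinants on the range of an idempotent. -/

section Compression

variable {V : Type*} [AddCommGroup V] [Module ℂ V] [FiniteDimensional ℂ V]

/-- The determinant of the compression of `A` to the range of `e`. -/
def compressionDet (e A : Module.End ℂ V) : ℂ :=
  LinearMap.det (e.rangeRestrict ∘ₗ A ∘ₗ (LinearMap.range e).subtype)

theorem rangeRestrict_comp_subtype {e : Module.End ℂ V} (he : e * e = e) :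
    e.rangeRestrict ∘ₗ (LinearMap.range e).subtype = LinearMap.id := by
  ext ⟨x, y, rfl⟩
  exact LinearMap.congr_fun he y

theorem compressionDet_one {e : Module.End ℂ V} (he : e * e = e) : compressionDet e 1 = 1 := by
  rw [compressionDet, Module.End.one_eq_id, LinearMap.id_comp, rangeRestrict_comp_subtype he,
    LinearMap.det_id]

/-- It is enough that the right factor preserves the range: then nothing is lost by projecting
between `B` and `A`. -/
theorem compressionDet_mul {e A B : Module.End ℂ V} (he : e * e = e) (hB : e * B = B * e) :
    compressionDet e (A * B) = compressionDet e A * compressionDet e B := by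
  rw [compressionDet, compressionDet, compressionDet, ← LinearMap.det_comp]
  congr 1
  have h1 : ∀ y, e (B (e y)) = B (e y) := fun y => by
    rw [← Module.End.mul_apply e B, hB, Module.End.mul_apply, ← Module.End.mul_apply e e, he]
  ext ⟨x, y, rfl⟩
  exact congrArg (fun z => e (A z)) (h1 y).symm

theorem compressionDet_smul (e A : Module.End ℂ V) (c : ℂ) :
    compressionDet e (c • A) =
      c ^ Module.finrank ℂ (LinearMap.range e) * compressionDet e A := by
  rw [compressionDet, LinearMap.smul_comp, LinearMap.comp_smul, LinearMap.det_smul]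
  rfl

theorem finrank_range_eq_trace {e : Module.End ℂ V} (he : e * e = e) :
    (Module.finrank ℂ (LinearMap.range e) : ℂ) = LinearMap.trace ℂ V e := by
  have : LinearMap.IsProj (LinearMap.range e) e :=
    ⟨fun x => ⟨x, rfl⟩, by rintro _ ⟨y, rfl⟩; exact LinearMap.congr_fun he y⟩
  exact (this.trace).symm

end Compression

/-! ### Even and odd functions, and the determinant quotient. -/

section Parity

variable (F : Type*) [Field F] [Fintype F] (ι : Type*) [Fintype ι] [DecidableEq ι]

/-- The operator `f(t) ↦ f(-t)`. -/
def parity : Module.End ℂ ((ι → F) → ℂ) := LinearMap.funLeft ℂ ℂ (fun t => -t)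

variable {F ι}

theorem parity_apply (f : (ι → F) → ℂ) (t : ι → F) : parity F ι f t = f (-t) := rfl

variable (F ι) in
theorem parity_mul_self : parity F ι * parity F ι = 1 := by
  ext1 f; funext t; simp [parity_apply]

theorem trace_eq_sum_single [DecidableEq (ι → F)] (A : Module.End ℂ ((ι → F) → ℂ)) :
    LinearMap.trace ℂ _ A = ∑ t, A (Pi.single t 1) t := by
  rw [LinearMap.trace_eq_matrix_trace ℂ (Pi.basisFun ℂ (ι → F)), Matrix.trace]
  simp

variable (ι) in
theorem trace_parity (h2 : (2 : F) ≠ 0) : LinearMap.trace ℂ _ (parity F ι) = 1 := by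
  classical
  rw [trace_eq_sum_single, Finset.sum_eq_single 0]
  · simp [parity_apply]
  · intro t _ ht
    rw [parity_apply, Pi.single_eq_of_ne]
    intro h
    apply ht
    have h3 : (2 : F) • t = 0 := by
      rw [two_smul]; nth_rw 1 [← h]; simp
    exact (smul_eq_zero.1 h3).resolve_left h2
  · simp

variable (F ι) in
/-- The projection to the even (`s = 1`) or odd (`s = -1`) functions. -/
def parityProj (s : ℂ) : Module.End ℂ ((ι → F) → ℂ) := (2⁻¹ : ℂ) • (1 + s • parity F ι)

theorem parityProj_mul_self {s : ℂ} (hs : s * s = 1) :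
    parityProj F ι s * parityProj F ι s = parityProj F ι s := by
  simp only [parityProj, mul_add, add_mul, one_mul, mul_one, smul_mul_assoc, mul_smul_comm,
    parity_mul_self]
  match_scalars
  · linear_combination (1 / 4 : ℂ) * hs
  · ring

theorem parityProj_commute {A : Module.End ℂ ((ι → F) → ℂ)}
    (hA : parity F ι * A = A * parity F ι) (s : ℂ) :
    parityProj F ι s * A = A * parityProj F ι s := by
  simp only [parityProj, mul_add, add_mul, one_mul, mul_one, smul_mul_assoc, mul_smul_comm, hA]

variable (ι) in
-- The difference of the two dimensions is the trace of parity, which is 1 since `t ↦ -t` fixes only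
-- 0.
theorem finrank_even (h2 : (2 : F) ≠ 0) :
    Module.finrank ℂ (LinearMap.range (parityProj F ι 1)) =
      Module.finrank ℂ (LinearMap.range (parityProj F ι (-1))) + 1 := by
  have h3 := finrank_range_eq_trace (parityProj_mul_self (F := F) (ι := ι) (s := 1) (by norm_num))
  have h4 := finrank_range_eq_trace (parityProj_mul_self (F := F) (ι := ι) (s := -1) (by norm_num))
  have h5 : ∀ s : ℂ, LinearMap.trace ℂ _ (parityProj F ι s) =
      2⁻¹ * (LinearMap.trace ℂ ((ι → F) → ℂ) 1 + s) := fun s => by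
    rw [parityProj, map_smul, map_add, map_smul, trace_parity ι h2, smul_eq_mul, smul_eq_mul,
      mul_one]
  rw [← @Nat.cast_inj ℂ]
  push_cast
  rw [h3, h4, h5, h5]
  ring

/-- The ratio of the determinants on the even and the odd functions. -/
def detRatio (A : Module.End ℂ ((ι → F) → ℂ)) : ℂ :=
  compressionDet (parityProj F ι 1) A / compressionDet (parityProj F ι (-1)) A

theorem detRatio_one : detRatio (1 : Module.End ℂ ((ι → F) → ℂ)) = 1 := by
  rw [detRatio, compressionDet_one (parityProj_mul_self (by norm_num)),
    compressionDet_one (parityProj_mul_self (by norm_num)), div_one]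

theorem detRatio_mul {A B : Module.End ℂ ((ι → F) → ℂ)}
    (hB : parity F ι * B = B * parity F ι) : detRatio (A * B) = detRatio A * detRatio B := by
  rw [detRatio, compressionDet_mul (parityProj_mul_self (by norm_num)) (parityProj_commute hB _),
    compressionDet_mul (parityProj_mul_self (by norm_num)) (parityProj_commute hB _),
    mul_div_mul_comm, detRatio, detRatio]

/-- The powers of `c` on the even and odd parts differ by exactly one, so every nonzero value can be
rescaled to 1 in a unique way. -/
theorem detRatio_smul (h2 : (2 : F) ≠ 0) {c : ℂ} (hc : c ≠ 0) (A : Module.End ℂ ((ι → F) → ℂ)) :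
    detRatio (c • A) = c * detRatio A := by
  rw [detRatio, compressionDet_smul, compressionDet_smul, finrank_even ι h2, detRatio, pow_succ,
    mul_assoc, mul_div_mul_left _ _ (pow_ne_zero _ hc), mul_div_assoc]

end Parity

/-! ### The projective representation lifts to a representation. -/

section Splitting

variable {p : ℕ} [Fact p.Prime] {F : Type*} [Field F] [Fintype F] [Algebra (ZMod p) F]
  {ι : Type*} [Fintype ι] [DecidableEq ι]

theorem parity_mul_schrodinger (v : ι ⊕ ι → F) :
    parity F ι * schrodinger p v = schrodinger p (-v) * parity F ι := by
  ext1 f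
  funext t
  have h (a : ι → ι ⊕ ι) : (-v) ∘ a = -(v ∘ a) := rfl
  simp only [Module.End.mul_apply, parity_apply, schrodinger_apply, h, neg_dotProduct,
    dotProduct_neg, mul_neg, neg_neg, sub_neg_eq_add]
  congr 2
  abel

/-- Conjugating `A` by parity gives another implementer of `g`, hence `c • A`. Then `A⁻¹PA = cP`,
and comparing traces, with `tr P = 1`, gives `c = 1`. -/
theorem Intertwines.parity_commute (hp : p ≠ 2) {g : symplecticGroup ι F}
    {A : Module.End ℂ ((ι → F) → ℂ)} (hA : Intertwines p g A) (hA0 : A ≠ 0) :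
    parity F ι * A = A * parity F ι := by
  have h1 : Intertwines p g (parity F ι * A * parity F ι) := by
    intro v
    have hv := parity_mul_schrodinger (p := p) (-v)
    rw [neg_neg] at hv
    rw [← mul_assoc, ← mul_assoc, ← hv, mul_assoc (parity F ι), hA, neg_vecMul, mul_assoc,
      mul_assoc, mul_assoc, mul_assoc, parity_mul_schrodinger]
  obtain ⟨c, hc⟩ := h1.exists_eq_smul hp hA hA0
  obtain ⟨u, rfl⟩ := hA.isUnit hp hA0
  have h2 : parity F ι * ↑u = c • ((u : Module.End ℂ ((ι → F) → ℂ)) * parity F ι) := by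
    rw [← smul_mul_assoc, ← hc, mul_assoc, parity_mul_self, mul_one]
  have h3 : (↑u⁻¹ : Module.End ℂ ((ι → F) → ℂ)) * (parity F ι * ↑u) = c • parity F ι := by
    rw [h2, mul_smul_comm, ← mul_assoc, u.inv_mul, one_mul]
  have h4 := congrArg (LinearMap.trace ℂ _) h3
  rw [LinearMap.trace_mul_comm, mul_assoc, u.mul_inv, mul_one, map_smul,
    trace_parity ι (two_ne_zero_of_odd F hp), smul_eq_mul, mul_one] at h4
  rw [h2, ← h4, one_smul]

theorem Intertwines.detRatio_ne_zero (hp : p ≠ 2) {g : symplecticGroup ι F}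
    {A : Module.End ℂ ((ι → F) → ℂ)} (hA : Intertwines p g A) (hA0 : A ≠ 0) :
    detRatio A ≠ 0 := by
  have hP := hA.parity_commute hp hA0
  obtain ⟨u, rfl⟩ := hA.isUnit hp hA0
  intro h
  have h1 := detRatio_mul (A := (↑u⁻¹ : Module.End ℂ ((ι → F) → ℂ))) hP
  rw [u.inv_mul, detRatio_one, h, mul_zero] at h1
  exact one_ne_zero h1

theorem exists_normalized_intertwines (hp : p ≠ 2) (g : symplecticGroup ι F) :
    ∃ A, Intertwines p g A ∧ A ≠ 0 ∧ detRatio A = 1 := by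
  obtain ⟨A, hA, hA0⟩ := exists_intertwines hp g
  have h := hA.detRatio_ne_zero hp hA0
  exact ⟨(detRatio A)⁻¹ • A, hA.smul _, smul_ne_zero (inv_ne_zero h) hA0, by
    rw [detRatio_smul (two_ne_zero_of_odd F hp) (inv_ne_zero h), inv_mul_cancel₀ h]⟩

theorem Intertwines.eq_of_detRatio (hp : p ≠ 2) {g : symplecticGroup ι F}
    {A B : Module.End ℂ ((ι → F) → ℂ)} (hA : Intertwines p g A) (hB : Intertwines p g B)
    (hA0 : A ≠ 0) (hB0 : B ≠ 0) (h : detRatio A = detRatio B) : A = B := by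
  obtain ⟨c, rfl⟩ := hA.exists_eq_smul hp hB hB0
  have hc : c ≠ 0 := by rintro rfl; simp at hA0
  rw [detRatio_smul (two_ne_zero_of_odd F hp) hc] at h
  rw [mul_left_eq_self₀.1 h |>.resolve_right (hB.detRatio_ne_zero hp hB0), one_smul]

theorem exists_implements (hp : p ≠ 2) :
    ∃ W : Representation ℂ (symplecticGroup ι F) ((ι → F) → ℂ), Implements p W := by
  choose A hA hA0 hd using fun g : symplecticGroup ι F => exists_normalized_intertwines hp g
  refine ⟨⟨⟨A, ?_⟩, fun g h => ?_⟩, fun g v => hA g v⟩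
  · exact (hA 1).eq_of_detRatio hp intertwines_one (hA0 1) one_ne_zero
      ((hd 1).trans detRatio_one.symm)
  · have h0 : A g * A h ≠ 0 :=
      (((hA g).isUnit hp (hA0 g)).mul ((hA h).isUnit hp (hA0 h))).ne_zero
    refine (hA _).eq_of_detRatio hp ((hA g).mul (hA h)) (hA0 _) h0 ?_
    rw [detRatio_mul ((hA h).parity_commute hp (hA0 h)), hd, hd, hd, mul_one]

end Splitting

/-! ### Passage from `n` to `n + 1` and existence of the Weil representation. -/

section Stabilization

variable {F : Type*} [Field F] [Fintype F] {ι : Type*} [Fintype ι] [DecidableEq ι]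

theorem stab_mul (g h : symplecticGroup ι F) : stab (g * h) = stab g * stab h := by
  apply Subtype.ext
  simp only [stab, Submonoid.coe_mul]
  conv_lhs => rw [← fromBlocks_toBlocks (g : Matrix (ι ⊕ ι) (ι ⊕ ι) F),
    ← fromBlocks_toBlocks (h : Matrix (ι ⊕ ι) (ι ⊕ ι) F), fromBlocks_multiply]
  simp [fromBlocks_multiply, fromBlocks_add]

theorem stab_one : stab (1 : symplecticGroup ι F) = 1 := by
  apply Subtype.ext
  simp [stab, ← fromBlocks_one]

/-- The operator `A ⊗ 1` on functions of one more variable. -/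
def tensorOne (A : Module.End ℂ ((ι → F) → ℂ)) : Module.End ℂ ((ι ⊕ Unit → F) → ℂ) where
  toFun f t := A (fun s => f (Sum.elim s (t ∘ Sum.inr))) (t ∘ Sum.inl)
  map_add' f g := by
    funext t
    exact congrFun (map_add A _ _) _
  map_smul' c f := by
    funext t
    exact congrFun (map_smul A c _) _

theorem tensorOne_apply (A : Module.End ℂ ((ι → F) → ℂ)) (f : (ι ⊕ Unit → F) → ℂ)
    (t : ι ⊕ Unit → F) :
    tensorOne A f t = A (fun s => f (Sum.elim s (t ∘ Sum.inr))) (t ∘ Sum.inl) := rfl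

theorem tensorOne_mul (A B : Module.End ℂ ((ι → F) → ℂ)) :
    tensorOne (A * B) = tensorOne A * tensorOne B := by
  ext1 f; funext t
  simp [tensorOne_apply]

theorem tensorOne_one : tensorOne (1 : Module.End ℂ ((ι → F) → ℂ)) = 1 := by
  ext1 f; funext t
  simp [tensorOne_apply]

theorem tensorOne_smul (c : ℂ) (A : Module.End ℂ ((ι → F) → ℂ)) :
    tensorOne (c • A) = c • tensorOne A := by
  ext1 f; funext t
  simp [tensorOne_apply]

theorem tensorOne_tensor (A : Module.End ℂ ((ι → F) → ℂ)) (f : (ι → F) → ℂ) (h : F → ℂ) :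
    tensorOne A (fun t => f (fun i => t (Sum.inl i)) * h (t (Sum.inr ()))) =
      fun t => A f (fun i => t (Sum.inl i)) * h (t (Sum.inr ())) := by
  funext t
  rw [tensorOne_apply]
  have : (fun s : ι → F => f (fun i => (Sum.elim s (t ∘ Sum.inr) : ι ⊕ Unit → F) (Sum.inl i)) *
      h ((Sum.elim s (t ∘ Sum.inr) : ι ⊕ Unit → F) (Sum.inr ()))) = h (t (Sum.inr ())) • f := by
    funext s
    simp [mul_comm]
  rw [this, map_smul]
  simp [mul_comm, Function.comp_def]

theorem tensorOne_injective :
    Function.Injective (tensorOne : Module.End ℂ ((ι → F) → ℂ) → _) := by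
  intro A B h
  ext1 f
  funext t
  have h1 := congrFun (LinearMap.congr_fun h (fun t => f (fun i => t (Sum.inl i)) * 1))
    (Sum.elim t 0)
  have h2 := fun A => tensorOne_tensor A f (fun _ => 1)
  rw [h2 A, h2 B] at h1
  simpa using h1

variable {p : ℕ} [Fact p.Prime] [Algebra (ZMod p) F]

variable (p) in
-- Splits off the last coordinate, which `stab g` leaves alone; this is how `A ⊗ 1` is seen to
-- implement `stab g`.
theorem schrodinger_sum (v : (ι ⊕ Unit) ⊕ (ι ⊕ Unit) → F) (f : (ι ⊕ Unit → F) → ℂ)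
    (t : ι ⊕ Unit → F) :
    schrodinger p v f t =
      psi p F (2 * (v (Sum.inl (Sum.inr ())) * t (Sum.inr ())) -
        v (Sum.inl (Sum.inr ())) * v (Sum.inr (Sum.inr ()))) *
      schrodinger p (fun j => v (Sum.map Sum.inl Sum.inl j))
        (fun s => f (Sum.elim s fun _ => t (Sum.inr ()) - v (Sum.inr (Sum.inr ()))))
        (t ∘ Sum.inl) := by
  simp only [schrodinger_apply, ← mul_assoc, ← AddChar.map_add_eq_mul]
  congr 2
  · simp [dotProduct]
    ring
  · funext i
    rcases i with i | i <;> rfl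

theorem Intertwines.tensorOne {g : symplecticGroup ι F} {A : Module.End ℂ ((ι → F) → ℂ)}
    (hA : Intertwines p g A) : Intertwines p (stab g) (tensorOne A) := by
  intro v
  ext1 f
  funext t
  obtain ⟨w, hdef⟩ : ∃ w, w = v ᵥ*
      (stab g : Matrix ((ι ⊕ Unit) ⊕ (ι ⊕ Unit)) ((ι ⊕ Unit) ⊕ (ι ⊕ Unit)) F) := ⟨_, rfl⟩
  have hw : ∀ i, w i =
      Sum.elim (Sum.elim (fun i => ((fun j => v (Sum.map Sum.inl Sum.inl j)) ᵥ*
          (g : Matrix (ι ⊕ ι) (ι ⊕ ι) F)) (Sum.inl i)) (fun _ => v (Sum.inl (Sum.inr ()))))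
        (Sum.elim (fun i => ((fun j => v (Sum.map Sum.inl Sum.inl j)) ᵥ*
          (g : Matrix (ι ⊕ ι) (ι ⊕ ι) F)) (Sum.inr i)) (fun _ => v (Sum.inr (Sum.inr ())))) i := by
    rintro ((i | i) | (i | i)) <;>
      simp [hdef, stab, vecMul, dotProduct, fromBlocks, toBlocks₁₁, toBlocks₁₂,
        toBlocks₂₁, toBlocks₂₂]
  have hw' : (fun j => w (Sum.map Sum.inl Sum.inl j)) =
      (fun j => v (Sum.map Sum.inl Sum.inl j)) ᵥ* (g : Matrix (ι ⊕ ι) (ι ⊕ ι) F) := by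
    funext j
    rw [hw]
    rcases j with j | j <;> rfl
  have hx : w (Sum.inl (Sum.inr ())) = v (Sum.inl (Sum.inr ())) :=
    hw _
  have hy : w (Sum.inr (Sum.inr ())) = v (Sum.inr (Sum.inr ())) :=
    hw _
  rw [← hdef, Module.End.mul_apply, Module.End.mul_apply, schrodinger_sum, tensorOne_apply]
  simp only [tensorOne_apply, schrodinger_sum p w, hw', hx, hy,
    Sum.elim_comp_inl, Sum.elim_inr, Sum.elim_comp_inr, Function.comp_apply]
  have := congrFun (LinearMap.congr_fun (hA fun j => v (Sum.map Sum.inl Sum.inl j))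
    (fun s => f (Sum.elim s fun _ => t (Sum.inr ()) - v (Sum.inr (Sum.inr ()))))) (t ∘ Sum.inl)
  simp only [Module.End.mul_apply] at this
  have h2 := fun c : ℂ => congrFun (map_smul A c
    (schrodinger p ((fun j => v (Sum.map Sum.inl Sum.inl j)) ᵥ* (g : Matrix (ι ⊕ ι) (ι ⊕ ι) F))
    (fun s => f (Sum.elim s fun _ => t (Sum.inr ()) - v (Sum.inr (Sum.inr ())))))) (t ∘ Sum.inl)
  refine Eq.trans ?_ (h2 _).symm
  rw [Pi.smul_apply, ← this]
  rfl

/-- For any lifts `W₀` and `W'`, Schur's lemma gives `W'(g ⊕ 1) = c(g) W₀(g) ⊗ 1`. Since `A ↦ A ⊗ 1`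
is injective and multiplicative, `c • W₀` is again a representation, and it satisfies the
normalization for every `n` and `q`. -/
theorem exists_isWeilRepresentation (hp : p ≠ 2) :
    ∃ W : Representation ℂ (symplecticGroup ι F) ((ι → F) → ℂ), IsWeilRepresentation p W := by
  obtain ⟨W₀, hW₀⟩ := exists_implements (p := p) (F := F) (ι := ι) hp
  obtain ⟨W', hW'⟩ := exists_implements (p := p) (F := F) (ι := ι ⊕ Unit) hp
  have hne : ∀ g, W₀ g ≠ 0 := fun g => ((Group.isUnit g).map W₀).ne_zero
  have hex : ∀ g, ∃ c : ℂ, W' (stab g) = c • tensorOne (W₀ g) := fun g =>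
    Intertwines.exists_eq_smul hp (hW' (stab g)) (Intertwines.tensorOne (hW₀ g))
      (((Group.isUnit g).map W₀).map (⟨⟨WeilSp.tensorOne, tensorOne_one⟩, tensorOne_mul⟩ :
        _ →* Module.End ℂ ((ι ⊕ Unit → F) → ℂ))).ne_zero
  choose c hc using hex
  refine ⟨⟨⟨fun g => c g • W₀ g, ?_⟩, fun g h => ?_⟩, fun g => (show Intertwines p g _ from
    (show Intertwines p g _ from hW₀ g).smul (c g)), fun _ _ => ⟨W', hW', fun g f h => ?_⟩⟩
  · apply tensorOne_injective
    rw [tensorOne_smul, ← hc, stab_one, map_one, tensorOne_one]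
  · apply tensorOne_injective
    simp only
    rw [tensorOne_smul, ← hc, tensorOne_mul, tensorOne_smul, tensorOne_smul, ← hc, ← hc, stab_mul,
      map_mul]
  · rw [hc, ← tensorOne_smul, tensorOne_tensor]
    rfl

end Stabilization

/-! ### Relations between symplectic matrices. -/

section Elements

variable {F : Type*} [Field F] {ι : Type*} [Fintype ι] [DecidableEq ι]

theorem gQ_congr {Q R : Matrix ι ι F} (h : Q = R) (hQ : Q.IsSymm) (hR : R.IsSymm) :
    gQ Q hQ = gQ R hR := by
  subst h; rfl

theorem gQ_mul {Q R : Matrix ι ι F} (hQ : Q.IsSymm) (hR : R.IsSymm) :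
    gQ Q hQ * gQ R hR = gQ (Q + R) (hQ.add hR) := by
  apply Subtype.ext
  simp [gQ, fromBlocks_multiply]

theorem gQ_zero : gQ (0 : Matrix ι ι F) isSymm_zero = 1 := by
  apply Subtype.ext
  simp [gQ]

theorem gQ_pow {Q : Matrix ι ι F} (hQ : Q.IsSymm) (n : ℕ) :
    gQ Q hQ ^ n = gQ (n • Q) (hQ.smul n) := by
  induction n with
  | zero => rw [pow_zero, gQ_congr (zero_smul ℕ Q) _ isSymm_zero, gQ_zero]
  | succ n ih => rw [pow_succ, ih, gQ_mul]; exact gQ_congr (succ_nsmul Q n).symm _ _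

theorem gQ_pow_char (p : ℕ) [CharP F p] {Q : Matrix ι ι F} (hQ : Q.IsSymm) :
    gQ Q hQ ^ p = 1 := by
  rw [gQ_pow, ← gQ_zero]
  apply gQ_congr
  ext i j
  simp

/-- The symplectic matrix with diagonal blocks `(D⁻¹)ᵀ` and `D`. -/
def levi (D : Matrix ι ι F) (hD : IsUnit D.det) : symplecticGroup ι F :=
  ⟨fromBlocks (D⁻¹)ᵀ 0 0 D, by
    rw [SymplecticGroup.mem_iff, J, fromBlocks_transpose, fromBlocks_multiply,
      fromBlocks_multiply]
    simp [← transpose_mul, mul_nonsing_inv D hD]⟩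

theorem levi_mul_gQ {D : Matrix ι ι F} (hD : IsUnit D.det) {Q : Matrix ι ι F} (hQ : Q.IsSymm)
    (hQ' : (D * Q * Dᵀ).IsSymm) : levi D hD * gQ Q hQ = gQ (D * Q * Dᵀ) hQ' * levi D hD := by
  apply Subtype.ext
  have : D * Q * Dᵀ * (D⁻¹)ᵀ = D * Q := by
    rw [Matrix.mul_assoc, ← transpose_mul, nonsing_inv_mul D hD, transpose_one, Matrix.mul_one]
  simp [levi, gQ, fromBlocks_multiply, this]

theorem isSymm_conj {Q : Matrix ι ι F} (hQ : Q.IsSymm) (D : Matrix ι ι F) :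
    (D * Q * Dᵀ).IsSymm := by
  rw [IsSymm, transpose_mul, transpose_mul, hQ.eq, transpose_transpose, Matrix.mul_assoc]

theorem neg_one_eq_symJ_mul_symJ :
    neg (1 : symplecticGroup ι F) = SymplecticGroup.symJ ι F * SymplecticGroup.symJ ι F := by
  apply Subtype.ext
  simp [neg, SymplecticGroup.coe_J, J_squared]

theorem neg_one_mul_neg_one :
    neg (1 : symplecticGroup ι F) * neg (1 : symplecticGroup ι F) = 1 := by
  apply Subtype.ext
  simp [neg]

theorem neg_eq_neg_one_mul (g : symplecticGroup ι F) : neg g = neg 1 * g := by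
  apply Subtype.ext
  simp [neg]

/-- This amounts to `J = L (J L J⁻¹) L` with `L = g_I`, so every linear character takes the same
value on `J` as on `L³`. -/
theorem symJ_mul_symJ_eq :
    SymplecticGroup.symJ ι F * SymplecticGroup.symJ ι F =
      gQ 1 isSymm_one * (SymplecticGroup.symJ ι F * gQ 1 isSymm_one *
        (SymplecticGroup.symJ ι F)⁻¹) * gQ 1 isSymm_one * SymplecticGroup.symJ ι F := by
  congr 1
  apply Subtype.ext
  simp [gQ, SymplecticGroup.coe_inv, SymplecticGroup.coe_J, J, fromBlocks_multiply,
    fromBlocks_transpose, fromBlocks_neg]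

theorem stab_gQ {Q : Matrix ι ι F} (hQ : Q.IsSymm) :
    ∃ h, stab (gQ Q hQ) = gQ (fromBlocks Q 0 0 0) h := by
  refine ⟨?_, ?_⟩
  · rw [IsSymm, fromBlocks_transpose, hQ.eq]; simp
  · apply Subtype.ext
    simp [stab, gQ, ← fromBlocks_one]

end Elements

/-! ### Explicit implementers of `g_Q` and `-1`. -/

section Operators

variable (p : ℕ) [Fact p.Prime] {F : Type*} [Field F] [Fintype F] [Algebra (ZMod p) F]
  {ι : Type*} [Fintype ι] [DecidableEq ι]

/-- The operator of multiplication by `t ↦ ψ(-t Q tᵀ)`. -/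
def mulPsi (Q : Matrix ι ι F) : Module.End ℂ ((ι → F) → ℂ) where
  toFun f t := psi p F (-quadForm Q t) * f t
  map_add' f g := by funext t; simp [mul_add]
  map_smul' c f := by funext t; simp [mul_left_comm]

variable {p}

theorem mulPsi_apply (Q : Matrix ι ι F) (f : (ι → F) → ℂ) (t : ι → F) :
    mulPsi p Q f t = psi p F (-quadForm Q t) * f t := rfl

theorem quadForm_zero (Q : Matrix ι ι F) : quadForm Q 0 = 0 := by simp [quadForm]

theorem mulPsi_single_zero [DecidableEq (ι → F)] (Q : Matrix ι ι F) :
    mulPsi p Q (Pi.single 0 1) 0 = 1 := by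
  simp [mulPsi_apply, quadForm_zero]

theorem mulPsi_ne_zero (Q : Matrix ι ι F) : mulPsi p Q ≠ 0 := by
  classical
  intro h
  have := mulPsi_single_zero (p := p) Q
  simp [h] at this

theorem intertwines_mulPsi {Q : Matrix ι ι F} (hQ : Q.IsSymm) :
    Intertwines p (gQ Q hQ) (mulPsi p Q) := by
  intro v
  have hv : v ᵥ* (gQ Q hQ : Matrix (ι ⊕ ι) (ι ⊕ ι) F) =
      Sum.elim (v ∘ Sum.inl + (v ∘ Sum.inr) ᵥ* Q) (v ∘ Sum.inr) := by
    rw [gQ, vecMul_fromBlocks]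
    simp
  ext1 f
  funext t
  rw [hv]
  simp only [Module.End.mul_apply, schrodinger_apply, mulPsi_apply, Sum.elim_comp_inl,
    Sum.elim_comp_inr, ← mul_assoc, ← AddChar.map_add_eq_mul]
  congr 2
  generalize v ∘ Sum.inl = x
  generalize v ∘ Sum.inr = y
  have h1 : ∀ s : ι → F, (y ᵥ* Q) ⬝ᵥ s = y ⬝ᵥ (Q *ᵥ s) := fun s => (dotProduct_mulVec y Q s).symm
  have h2 : t ⬝ᵥ (Q *ᵥ y) = y ⬝ᵥ (Q *ᵥ t) := by
    rw [dotProduct_mulVec, ← mulVec_transpose, hQ.eq, dotProduct_comm]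
  simp only [quadForm, mulVec_sub, sub_dotProduct, dotProduct_sub, add_dotProduct, h1, h2]
  ring

theorem trace_mulPsi (Q : Matrix ι ι F) :
    LinearMap.trace ℂ _ (mulPsi p Q) = ∑ t, psi p F (-quadForm Q t) := by
  classical
  rw [trace_eq_sum_single]
  simp [mulPsi_apply]

theorem trace_parity_mul_mulPsi (hp : p ≠ 2) (Q : Matrix ι ι F) :
    LinearMap.trace ℂ _ (parity F ι * mulPsi p Q) = 1 := by
  classical
  rw [trace_eq_sum_single, Finset.sum_eq_single 0]
  · simp [parity_apply, mulPsi_apply, quadForm_zero]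
  · intro t _ ht
    rw [Module.End.mul_apply, parity_apply, mulPsi_apply, Pi.single_eq_of_ne, mul_zero]
    intro h
    apply ht
    have h3 : (2 : F) • t = 0 := by
      rw [two_smul]; nth_rw 1 [← h]; simp
    exact (smul_eq_zero.1 h3).resolve_left (two_ne_zero_of_odd F hp)
  · simp

theorem intertwines_parity : Intertwines p (neg (1 : symplecticGroup ι F)) (parity F ι) := by
  intro v
  have : v ᵥ* (neg (1 : symplecticGroup ι F) : Matrix (ι ⊕ ι) (ι ⊕ ι) F) = -v := by
    simp [neg, vecMul_neg]
  rw [this, parity_mul_schrodinger, neg_neg]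

/-- Negation fixes only 0, so it is a product of `(q^n - 1)/2` transpositions. Its sign is `χ₄(q^n)
= χ₄(q)^n`, and `χ₄(q) = χ(-1)`. -/
theorem det_parity [DecidableEq F] (h2 : ringChar F ≠ 2) :
    LinearMap.det (parity F ι) = delta F ^ Fintype.card ι := by
  have hodd := FiniteField.odd_card_of_char_ne_two h2
  have hm : LinearMap.toMatrix' (parity F ι) =
      (1 : Matrix (ι → F) (ι → F) ℂ).submatrix (Equiv.neg (ι → F)) id := by
    ext s t
    simp [LinearMap.toMatrix'_apply, parity_apply, Matrix.one_apply, Pi.single_apply, eq_comm]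
  have hfix : Fintype.card (Function.fixedPoints (Equiv.neg (ι → F))) = 1 := by
    rw [Fintype.card_eq_one_iff]
    refine ⟨⟨0, by simp [Function.mem_fixedPoints, Function.IsFixedPt]⟩, fun ⟨t, ht⟩ => ?_⟩
    apply Subtype.ext
    have ht : -t = t := ht
    have h3 : (2 : F) • t = 0 := by
      rw [two_smul]; nth_rw 1 [← ht]; simp
    exact (smul_eq_zero.1 h3).resolve_left (Ring.two_ne_zero h2)
  have hsign := Equiv.Perm.sign_of_pow_two_eq_one (σ := Equiv.neg (ι → F))
    (by ext t; simp [sq])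
  have hN : (Fintype.card (ι → F)) % 2 = 1 := by
    rw [Fintype.card_fun, ← Nat.odd_iff]
    exact (Nat.odd_iff.2 hodd).pow
  have hdelta : (quadraticChar F (-1)) ^ Fintype.card ι = (-1) ^ (Fintype.card (ι → F) / 2) := by
    rw [← ZMod.χ₄_eq_neg_one_pow hN, quadraticChar_neg_one h2, ← map_pow, Fintype.card_fun]
    push_cast
    rfl
  rw [← LinearMap.det_toMatrix', hm, Matrix.det_permute, hsign, hfix, Matrix.det_one, mul_one,
    delta, chi, ← Int.cast_pow, hdelta]
  have : (Fintype.card (ι → F) - 1) / 2 = Fintype.card (ι → F) / 2 := by omega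
  rw [this]
  push_cast
  rfl

end Operators

/-! ### The scalars relating `W` to the explicit implementers. -/

section Values

variable {p : ℕ} [Fact p.Prime] {F : Type*} [Field F] [Fintype F] [Algebra (ZMod p) F]
  {ι : Type*} [Fintype ι] [DecidableEq ι]

theorem eq_one_of_sq_of_pow_odd {x : ℂ} (hp : p ≠ 2) (h2 : x * x = 1) (hx : x ^ p = 1) :
    x = 1 := by
  obtain ⟨k, hk⟩ := (Fact.out : p.Prime).odd_of_ne_two hp
  rwa [hk, pow_succ, pow_mul, sq, h2, one_pow, one_mul] at hx

theorem sum_psi_quadForm_ne_zero (hp : p ≠ 2) {Q : Matrix ι ι F} (hQ : Q.IsSymm) :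
    ∑ t, psi p F (-quadForm Q t) ≠ 0 := by
  classical
  rw [sum_psi_quadForm hp hQ, Delta,
    dif_pos (exists_isDiagonalization (two_ne_zero_of_odd F hp) hQ)]
  refine mul_ne_zero (mul_ne_zero (pow_ne_zero _ (Nat.cast_ne_zero.2 Fintype.card_ne_zero))
    (zpow_ne_zero _ (rho_ne_zero F hp))) fun h => ?_
  rw [chi_prod, Finset.prod_eq_zero_iff] at h
  obtain ⟨i, hi, h⟩ := h
  have := chi_sq F (Finset.mem_filter.1 hi).2
  rw [h] at this
  norm_num at this

open Classical in
/-- The factor by which `W(g_Q)` differs from the multiplication by `ψ(-t Q tᵀ)`. -/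
def unipotentScalar (W : Representation ℂ (symplecticGroup ι F) ((ι → F) → ℂ))
    (Q : Matrix ι ι F) (hQ : Q.IsSymm) : ℂ := W (gQ Q hQ) (Pi.single 0 1) 0

variable {W : Representation ℂ (symplecticGroup ι F) ((ι → F) → ℂ)} (hp : p ≠ 2)
  (hW : Implements p W)
include hp hW

theorem Implements.apply_gQ {Q : Matrix ι ι F} (hQ : Q.IsSymm) :
    W (gQ Q hQ) = unipotentScalar W Q hQ • mulPsi p Q := by
  obtain ⟨c, hc⟩ := Intertwines.exists_eq_smul hp (hW (gQ Q hQ)) (intertwines_mulPsi hQ)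
    (mulPsi_ne_zero Q)
  have : unipotentScalar W Q hQ = c := by
    rw [unipotentScalar, hc]
    simp [mulPsi_apply, quadForm_zero]
  rw [this, hc]

theorem Implements.unipotentScalar_add {Q R : Matrix ι ι F} (hQ : Q.IsSymm) (hR : R.IsSymm)
    (hQR : (Q + R).IsSymm) :
    unipotentScalar W (Q + R) hQR = unipotentScalar W Q hQ * unipotentScalar W R hR := by
  classical
  rw [unipotentScalar, ← gQ_mul hQ hR, map_mul, hW.apply_gQ hp hQ, hW.apply_gQ hp hR]
  simp [mulPsi_apply, quadForm_zero, mul_comm]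

omit hp hW in
theorem unipotentScalar_zero (h : (0 : Matrix ι ι F).IsSymm) : unipotentScalar W 0 h = 1 := by
  classical
  rw [unipotentScalar, gQ_zero, map_one]
  simp

theorem Implements.unipotentScalar_nsmul {Q : Matrix ι ι F} (hQ : Q.IsSymm) (n : ℕ)
    (h : (n • Q).IsSymm) : unipotentScalar W (n • Q) h = unipotentScalar W Q hQ ^ n := by
  induction n with
  | zero => simp only [zero_smul, unipotentScalar_zero, pow_zero]
  | succ n ih =>
    simp only [succ_nsmul]
    rw [hW.unipotentScalar_add hp (hQ.smul n) hQ, ih, pow_succ]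

theorem Implements.unipotentScalar_pow_char {Q : Matrix ι ι F} (hQ : Q.IsSymm) :
    unipotentScalar W Q hQ ^ p = 1 := by
  have := charP_of_algebra p F
  have h : p • Q = 0 := by ext i j; simp
  rw [← hW.unipotentScalar_nsmul hp hQ p (hQ.smul p)]
  simp only [h, unipotentScalar_zero]

theorem Implements.unipotentScalar_ne_zero {Q : Matrix ι ι F} (hQ : Q.IsSymm) :
    unipotentScalar W Q hQ ≠ 0 := by
  intro h
  have := hW.unipotentScalar_pow_char hp hQ
  rw [h, zero_pow (Fact.out : p.Prime).ne_zero] at this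
  exact zero_ne_one this

theorem Implements.character_gQ {Q : Matrix ι ι F} (hQ : Q.IsSymm) :
    W.character (gQ Q hQ) = unipotentScalar W Q hQ * ∑ t, psi p F (-quadForm Q t) := by
  rw [Representation.character, hW.apply_gQ hp hQ, map_smul, trace_mulPsi, smul_eq_mul]

/-- The two group elements are conjugate, so their characters agree; the Gauss sums agree as well
and are nonzero, so they cancel. -/
theorem Implements.unipotentScalar_conj {D Q : Matrix ι ι F} (hD : IsUnit D.det) (hQ : Q.IsSymm)
    (hQ' : (D * Q * Dᵀ).IsSymm) :
    unipotentScalar W (D * Q * Dᵀ) hQ' = unipotentScalar W Q hQ := by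
  have h := Representation.char_conj W (gQ Q hQ) (levi D hD)
  rw [levi_mul_gQ hD hQ hQ', mul_inv_cancel_right, hW.character_gQ hp, hW.character_gQ hp,
    sum_quadForm_conj (fun a => psi p F (-a)) Q D hD] at h
  exact mul_right_cancel₀ (sum_psi_quadForm_ne_zero hp hQ) h

theorem Implements.unipotentScalar_eq_one_of_card (h3 : 3 < Fintype.card F) {Q : Matrix ι ι F}
    (hQ : Q.IsSymm) : unipotentScalar W Q hQ = 1 := by
  classical
  -- Writing `λ` for the scalar and `Q = (s² - 1)R`, congruence by `s • 1` gives `λ(Q)λ(R) = λ(s²R)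
  -- = λ(R)`.
  obtain ⟨s, hs⟩ : ∃ s : F, s ∉ ({0, 1, -1} : Finset F) := by
    by_contra! h
    have := Finset.card_le_card (fun s _ => h s : (Finset.univ : Finset F) ⊆ {0, 1, -1})
    have := Finset.card_le_three (a := (0 : F)) (b := 1) (c := -1)
    rw [Finset.card_univ] at *
    omega
  simp only [Finset.mem_insert, Finset.mem_singleton, not_or] at hs
  have hs1 : s ^ 2 - 1 ≠ 0 := by
    rw [sub_ne_zero]
    exact fun h => (sq_eq_one_iff.1 h).elim hs.2.1 hs.2.2
  obtain ⟨R, rfl⟩ : ∃ R, Q = (s ^ 2 - 1) • R := ⟨(s ^ 2 - 1)⁻¹ • Q, by simp [smul_smul, hs1]⟩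
  have hR : R.IsSymm := by
    have := hQ.smul (s ^ 2 - 1)⁻¹
    rwa [smul_smul, inv_mul_cancel₀ hs1, one_smul] at this
  have hD : IsUnit (s • (1 : Matrix ι ι F)).det := by
    rw [det_smul, det_one, mul_one]; exact (isUnit_iff_ne_zero.2 hs.1).pow _
  have h := hW.unipotentScalar_conj hp hD hR (isSymm_conj hR _)
  have e : (s • (1 : Matrix ι ι F)) * R * (s • (1 : Matrix ι ι F))ᵀ = (s ^ 2 - 1) • R + R := by
    simp [smul_smul, sub_smul, sq]
  simp only [e] at h
  rw [hW.unipotentScalar_add hp hQ hR] at h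
  exact mul_eq_right₀ (hW.unipotentScalar_ne_zero hp hR) |>.1 h

omit hp hW in
theorem isSymm_single_diag (i : ι) (a : F) : (Matrix.single i i a).IsSymm := by
  rw [IsSymm, transpose_single]

theorem Implements.unipotentScalar_single [Nontrivial ι] (j : ι) (a : F) :
    unipotentScalar W (Matrix.single j j a) (isSymm_single_diag j a) = 1 := by
  obtain ⟨i, hij⟩ := exists_ne j
  have hx := isSymm_single_diag i a
  have hy := isSymm_single_diag j a
  have hD : ∀ s : F, IsUnit (transvection j i s).det := fun s => by
    rw [det_transvection_of_ne _ _ hij.symm]; exact isUnit_one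
  -- The cross terms of the two transvections cancel. Comparing scalars leaves the square of the one
  -- for `single j j a` equal to 1, and its order is odd.
  have e : transvection j i 1 * single i i a * (transvection j i 1)ᵀ +
      transvection j i (-1) * single i i a * (transvection j i (-1))ᵀ =
      (single i i a + single i i a) + (single j j a + single j j a) := by
    simp only [transvection, transpose_add, transpose_one, transpose_single, add_mul, mul_add,
      single_mul_single_same, one_mul, mul_one, mul_neg, neg_mul,
      neg_neg]
    simp only [← single_neg]
    abel
  have h := hW.unipotentScalar_add hp (isSymm_conj hx (transvection j i 1))
    (isSymm_conj hx (transvection j i (-1))) ((isSymm_conj hx _).add (isSymm_conj hx _))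
  rw [hW.unipotentScalar_conj hp (hD _) hx, hW.unipotentScalar_conj hp (hD _) hx] at h
  simp only [e] at h
  rw [hW.unipotentScalar_add hp (hx.add hx) (hy.add hy), hW.unipotentScalar_add hp hx hx,
    hW.unipotentScalar_add hp hy hy] at h
  have h0 := hW.unipotentScalar_ne_zero hp hx
  exact eq_one_of_sq_of_pow_odd hp (mul_eq_left₀ (mul_ne_zero h0 h0) |>.1 h)
    (hW.unipotentScalar_pow_char hp hy)

theorem Implements.unipotentScalar_eq_one_of_nontrivial [Nontrivial ι] {Q : Matrix ι ι F}
    (hQ : Q.IsSymm) : unipotentScalar W Q hQ = 1 := by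
  obtain ⟨d, P, hP, h⟩ := exists_isDiagonalization (two_ne_zero_of_odd F hp) hQ
  have hs : ∀ s : Finset ι, (∑ i ∈ s, Matrix.single i i (d i)).IsSymm := fun s => by
    simp only [IsSymm, transpose_sum, transpose_single]
  have key : ∀ s : Finset ι, unipotentScalar W (∑ i ∈ s, Matrix.single i i (d i)) (hs s) = 1 := by
    intro s
    induction s using Finset.induction_on with
    | empty => simp only [Finset.sum_empty, unipotentScalar_zero]
    | insert i s hi ih =>
      simp only [Finset.sum_insert hi]
      rw [hW.unipotentScalar_add hp (isSymm_single_diag _ _) (hs s), ih, mul_one,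
        hW.unipotentScalar_single hp]
  rw [← hW.unipotentScalar_conj hp hP hQ (isSymm_conj hQ P), ← key Finset.univ]
  congr 1
  rw [h]
  ext k l
  simp [Matrix.sum_apply, single_apply, diagonal_apply, ite_and]

theorem Implements.det_neg_one : LinearMap.det (W (neg 1)) = 1 := by
  have := charP_of_algebra p F
  let θ : symplecticGroup ι F →* ℂ := LinearMap.det.comp W
  -- The relation for `J²` gives `θ(J) = θ(L)³`, so `θ(-1) = θ(L)⁶` is a `p`-th root of unity as
  -- well as a sign.
  set L := gQ (1 : Matrix ι ι F) isSymm_one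
  set j := SymplecticGroup.symJ ι F with hj
  have h1 : θ j * θ j⁻¹ = 1 := by rw [← map_mul, mul_inv_cancel, map_one]
  have h2 : θ j * θ j = θ L ^ 3 * θ j := by
    have := congrArg θ (symJ_mul_symJ_eq (ι := ι) (F := F))
    simp only [map_mul] at this
    linear_combination this + θ L ^ 3 * θ j * h1
  have h3 : θ L ^ p = 1 := by rw [← map_pow, gQ_pow_char p, map_one]
  have h4 : θ j = θ L ^ 3 := by linear_combination θ j⁻¹ * h2 + (θ L ^ 3 - θ j) * h1
  have h5 : θ (neg 1) = (θ L ^ 3) ^ 2 := by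
    rw [neg_one_eq_symJ_mul_symJ, map_mul, ← hj, h4, sq]
  apply eq_one_of_sq_of_pow_odd hp
  · exact (map_mul θ _ _).symm.trans (by rw [neg_one_mul_neg_one, map_one])
  · change θ (neg 1) ^ p = 1
    have h6 : ((θ L ^ 3) ^ 2) ^ p = (θ L ^ p) ^ 6 := by ring
    rw [h5, h6, h3, one_pow]

theorem Implements.apply_neg_one [DecidableEq F] :
    W (neg 1) = (delta F ^ Fintype.card ι) • parity F ι := by
  have hP : parity F ι ≠ 0 := fun h => by
    have := parity_mul_self F ι
    rw [h, mul_zero] at this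
    exact zero_ne_one this
  obtain ⟨c, hc⟩ := Intertwines.exists_eq_smul hp (hW (neg 1)) intertwines_parity hP
  have hcc : c * c = 1 := by
    have h1 : W (neg 1) * W (neg 1) = 1 := by rw [← map_mul, neg_one_mul_neg_one, map_one]
    rw [hc, smul_mul_smul_comm, parity_mul_self] at h1
    have := congrArg (fun A => A (fun _ => 1) 0) h1
    simpa using this
  have hdet := hW.det_neg_one hp
  have hodd : Odd (Fintype.card (ι → F)) := by
    rw [Fintype.card_fun]
    exact (Nat.odd_iff.2 (FiniteField.odd_card_of_char_ne_two (ringChar_ne_two F hp))).pow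
  obtain ⟨k, hk⟩ := hodd
  -- As `c² = 1` and `q^n` is odd, `c^(q^n) = c`, so the determinant condition becomes `c δ^n = 1`.
  rw [hc, LinearMap.det_smul, Module.finrank_fintype_fun_eq_card, hk, pow_succ, pow_mul, sq, hcc,
    one_pow, one_mul, det_parity (ringChar_ne_two F hp)] at hdet
  rw [hc]
  congr 1
  calc c = c * (c * _) := by rw [hdet, mul_one]
    _ = _ := by rw [← mul_assoc, hcc, one_mul]

omit hW in
theorem IsWeilRepresentation.unipotentScalar_eq_one (hW : IsWeilRepresentation p W)
    {Q : Matrix ι ι F} (hQ : Q.IsSymm) : unipotentScalar W Q hQ = 1 := by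
  classical
  rcases subsingleton_or_nontrivial ι with hι | hι
  · rcases isEmpty_or_nonempty ι with he | he
    · obtain rfl := Subsingleton.elim Q 0
      exact unipotentScalar_zero hQ
    · have hc1 : Fintype.card ι = 1 :=
        le_antisymm (Fintype.card_le_one_iff_subsingleton.2 hι) Fintype.card_pos
      by_cases hq : Fintype.card F = 3
      · obtain ⟨W', hW', h⟩ := hW.2 hc1 hq
        obtain ⟨hs, hg⟩ := stab_gQ hQ
        have : Nontrivial (ι ⊕ Unit) := ⟨⟨Sum.inl he.some, Sum.inr (), by simp⟩⟩
        -- Evaluating `W'(g ⊕ 1) = W(g) ⊗ 1` on a product of point masses at 0 identifies the scalar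
        -- of `W` with that of `W'`, which is 1 as there are now two coordinates.
        have h1 := congrFun (h (gQ Q hQ) (Pi.single 0 1) (Pi.single 0 1)) 0
        rw [hg, hW'.apply_gQ hp hs, hW'.unipotentScalar_eq_one_of_nontrivial hp, one_smul,
          mulPsi_apply, quadForm_zero] at h1
        have h0 : (fun _ : ι => (0 : F)) = 0 := rfl
        simp [h0] at h1
        rw [unipotentScalar]
        convert h1.symm
      · refine hW.1.unipotentScalar_eq_one_of_card hp ?_ hQ
        have h2 := FiniteField.odd_card_of_char_ne_two (ringChar_ne_two F hp)
        have := Fintype.one_lt_card (α := F)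
        omega
  · exact hW.1.unipotentScalar_eq_one_of_nontrivial hp hQ

end Values

end WeilSp

end

theorem proposition4p1 (p : ℕ) [Fact p.Prime] (hp : p ≠ 2)
    (F : Type*) [Field F] [Fintype F] [DecidableEq F] [Algebra (ZMod p) F] (n : ℕ) :
    (∃ W : Representation ℂ (Matrix.symplecticGroup (Fin n) F) ((Fin n → F) → ℂ),
      WeilSp.IsWeilRepresentation p W) ∧
    ∀ W : Representation ℂ (Matrix.symplecticGroup (Fin n) F) ((Fin n → F) → ℂ),
      WeilSp.IsWeilRepresentation p W →
      ∀ (Q : Matrix (Fin n) (Fin n) F) (hQ : Q.IsSymm),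
        W.character (WeilSp.gQ Q hQ)
            = (Fintype.card F : ℂ) ^ n * (WeilSp.rho p F) ^ (-(Q.rank : ℤ)) * WeilSp.Delta Q ∧
        W.character (WeilSp.neg (WeilSp.gQ Q hQ)) = (WeilSp.delta F) ^ n := by
  refine ⟨WeilSp.exists_isWeilRepresentation hp, fun W hW Q hQ => ⟨?_, ?_⟩⟩
  · rw [hW.1.character_gQ hp, hW.unipotentScalar_eq_one hp, one_mul,
      WeilSp.sum_psi_quadForm hp hQ, Fintype.card_fin]
  · rw [WeilSp.neg_eq_neg_one_mul, Representation.character, map_mul, hW.1.apply_neg_one hp,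
      hW.1.apply_gQ hp hQ, hW.unipotentScalar_eq_one hp, one_smul, smul_mul_assoc, map_smul,
      WeilSp.trace_parity_mul_mulPsi hp, smul_eq_mul, mul_one, Fintype.card_fin]
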